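/- \textbf{Setting.} Let $P_{\rm t},P_{\rm E},\sigma^2>0$, $a=P_{\rm t}/P_{\rm E}$, $\gamma=P_{\rm t}/\sigma^2$. A frame has $m$ harvesting slots followed by $n$ transmission slots. In the harvesting slots the transmitter saves the energies $Z_1=\dots=Z_m=Z$, where $Z$ is exponentially distributed with mean $P_{\rm E}$. In the transmission slots it sends reals $\tilde X_1,\dots,\tilde X_n$ subject to $\sum_{\ell\le k}\tilde X_\ell^2\le\sum_{i\le m}Z_i$ for $k=1,\dots,n$, and the receiver observes $Y_\ell=\tilde X_\ell+V_\ell$ with i.i.d. noise $V_\ell\sim\mathcal N(0,\sigma^2)$ independent of $Z$. The message $W$ is uniform on $\{1,\dots,M\}$, $M\ge1$. Given a codebook $X^n(1),\dots,X^n(M)\in\mathbb R^n$, the transmitter sends $\tilde X_\ell=X_\ell(W)$ if $\sum_{j\le\ell}X_j(W)^2\le\sum_{i\le m}Z_i$ and $\tilde X_\ell=0$ otherwise. The threshold decoder outputs $i$ if $i$ is the unique message with $$\ln\frac{p_{Y^n|X^n}(Y^n|X^n(i))}{p_{Y^n}(Y^n)}>\ln M+n^{1/4},$$ and otherwise a fallback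 message; here $p_{Y^n|X^n}(\cdot|x)$ is the density of $x+V^n$ and $p_{Y^n}$ is the density of $n$ i.i.d. $\mathcal N(0,P_{\rm t}+\sigma^2)$ variables. In the random Gaussian codebook all $X_\ell(i)$ are i.i.d. $\mathcal N(0,P_{\rm t})$ and the fallback message is uniform, and codebook, fallback, $W$, $Z$ and $V^n$ are independent. \textbf{Theorem.} Let $0<\varepsilon<1$ and let $(m,n)$ be non-negative integers with $$m\ge\frac{2a}{\exp\!\left(\frac{2\ln(1+0.5\varepsilon)}{\left(\ln\frac{2+\varepsilon}{\varepsilon^2}\right)^4}\right)-1}\qquad\text{and}\qquad n\le\frac{2\ln(1+0.5\varepsilon)}{\ln(1+2a/m)}$$ (the first condition implies $m>2a$). Then the rate $$R_{\rm EH}(\varepsilon,m,n,a,\gamma)=\frac{\frac n2\ln(1+\gamma)-\sqrt{\frac{2+\varepsilon}{\varepsilon}\cdot\frac{\gamma}{1+\gamma}\,n}-n^{1/4}-1}{n+m}$$ (in nats per channel use) is $\varepsilon$-achievable with harvest blocklength $m$ and transmit blocklength $n$ by a Gaussian codebook with threshold decoding: there is an integer $M\ge1$ with $\frac{\ln M}{n+m}\ge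 R_{\rm EH}$ such that the random Gaussian codebook of size $M$ with threshold decoding has $\Pr[\hat W\ne W]\le\varepsilon$, and there are also a deterministic codebook of size $M$ and a deterministic fallback message for which the average error probability over $W$, $Z$ and $V^n$ is at most $\varepsilon$. -/

import Mathlib

open MeasureTheory ProbabilityTheory
open scoped NNReal

noncomputable section

namespace WPC

/-! A wireless-powered transmitter with a save-then-transmit frame: `m` harvesting slots followed by
`n` transmission slots over a real additive white Gaussian noise channel. -/

/-- The energy constraints: for every `k`, the energy spent on the first `k` transmitted symbols is
at most the energy saved in the harvesting phase. -/
def EnergyFeasible {m n : ℕ} (z : Fin m → ℝ) (x : Fin n → ℝ) : Prop :=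
  ∀ k : Fin n, ∑ l ∈ Finset.Iic k, x l ^ 2 ≤ ∑ i, z i

/-- Law of the harvested energies `(Z_1, …, Z_m)` under quasi-static Rayleigh fading: all of them
equal one exponential random variable with mean `PE`. -/
def harvestLaw (m : ℕ) (PE : ℝ≥0) : Measure (Fin m → ℝ) :=
  (expMeasure (PE : ℝ)⁻¹).map (fun z _ => z)

/-- Law of `n` independent centred Gaussian random variables of variance `v`. -/
def iidGaussian (n : ℕ) (v : ℝ≥0) : Measure (Fin n → ℝ) :=
  Measure.pi fun _ => gaussianReal 0 v

/-- A code with `M` messages for a frame with `m` harvesting and `n` transmission slots. The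
transmitted sequence depends on the message and on the harvested energies, all of which are known
when the transmission starts, and it respects the energy constraints; the receiver sees only the
channel output. -/
structure EHCode (m n M : ℕ) where
  /-- the transmitted sequence -/
  encode : Fin M → (Fin m → ℝ) → Fin n → ℝ
  measurable_encode : ∀ w, Measurable (encode w)
  feasible : ∀ w z, (∀ i, 0 ≤ z i) → EnergyFeasible z (encode w z)
  /-- the decoding function -/
  decode : (Fin n → ℝ) → Fin M
  measurable_decode : Measurable decode

/-- Average probability of decoding error: uniform message, random harvested energies with mean
`PE`, independent Gaussian noise of variance `σ2`. -/
def EHCode.errorProb {m n M : ℕ} (C : EHCode m n M) (PE σ2 : ℝ≥0) : ℝ :=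
  ((uniformOn (Set.univ : Set (Fin M))).prod
      ((harvestLaw m PE).prod (iidGaussian n σ2))).real
    {p | C.decode (C.encode p.1 p.2.1 + p.2.2) ≠ p.1}

open Classical in
/-- The sequence put on the channel when the intended codeword is `x` and the saved energies are
`z`: the intended symbol in every slot whose energy constraint holds, and `0` otherwise. -/
def transmit {m n : ℕ} (x : Fin n → ℝ) (z : Fin m → ℝ) : Fin n → ℝ := fun l =>
  if ∑ j ∈ Finset.Iic l, x j ^ 2 ≤ ∑ i, z i then x l else 0

/-- The density of the channel output `y` given the channel input `x`. -/
def channelPDF {n : ℕ} (σ2 : ℝ≥0) (x y : Fin n → ℝ) : ℝ :=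
  ∏ l, gaussianPDFReal (x l) σ2 (y l)

/-- The density at `y` of the output `X + V` for independent `X_l ∼ N(0, Pt)`,
`V_l ∼ N(0, σ2)`. -/
def outputPDF {n : ℕ} (Pt σ2 : ℝ≥0) (y : Fin n → ℝ) : ℝ :=
  ∏ l, gaussianPDFReal 0 (Pt + σ2) (y l)

/-- The threshold rule: the information density between the codeword `x` and the output `y`
exceeds `log M + n ^ (1/4)`. -/
def PassesThreshold {n : ℕ} (Pt σ2 : ℝ≥0) (M : ℕ) (x y : Fin n → ℝ) : Prop :=
  Real.log M + (n : ℝ) ^ (1 / 4 : ℝ) < Real.log (channelPDF σ2 x y / outputPDF Pt σ2 y)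

open Classical in
/-- The unique index satisfying `S` if there is exactly one, and the fallback `u` otherwise. -/
def uniqueOr {M : ℕ} (u : Fin M) (S : Fin M → Prop) : Fin M :=
  if h : ∃! i, S i then h.exists.choose else u

/-- Threshold decoding with codebook `c`: the unique message whose codeword passes the threshold,
and the message `u` when there is no such unique message. -/
def thresholdDecode {n M : ℕ} (Pt σ2 : ℝ≥0) (c : Fin M → Fin n → ℝ) (u : Fin M)
    (y : Fin n → ℝ) : Fin M :=
  uniqueOr u fun i => PassesThreshold Pt σ2 M (c i) y

theorem measurable_transmit {m n : ℕ} (x : Fin n → ℝ) :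
    Measurable (transmit x : (Fin m → ℝ) → Fin n → ℝ) := by
  refine measurable_pi_iff.2 fun l => ?_
  unfold transmit
  refine Measurable.ite (measurableSet_le measurable_const ?_) measurable_const measurable_const
  fun_prop

theorem energyFeasible_transmit {m n : ℕ} (x : Fin n → ℝ) (z : Fin m → ℝ)
    (hz : ∀ i, 0 ≤ z i) : EnergyFeasible z (transmit x z) := by
  classical
  intro k
  set F := (Finset.Iic k).filter fun l => ∑ j ∈ Finset.Iic l, x j ^ 2 ≤ ∑ i, z i with hF
  have h1 : ∑ l ∈ Finset.Iic k, transmit x z l ^ 2 = ∑ l ∈ F, x l ^ 2 := by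
    rw [hF, Finset.sum_filter]
    refine Finset.sum_congr rfl fun l _ => ?_
    unfold transmit
    split_ifs <;> simp
  rw [h1]
  rcases F.eq_empty_or_nonempty with h | h
  · rw [h, Finset.sum_empty]
    exact Finset.sum_nonneg fun i _ => hz i
  · have h2 := F.max'_mem h
    have h3 : ∑ j ∈ Finset.Iic (F.max' h), x j ^ 2 ≤ ∑ i, z i := (Finset.mem_filter.1 h2).2
    refine le_trans (Finset.sum_le_sum_of_subset_of_nonneg ?_ fun _ _ _ => sq_nonneg _) h3
    intro l hl
    exact Finset.mem_Iic.2 (F.le_max' l hl)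

theorem measurable_thresholdDecode {n M : ℕ} (Pt σ2 : ℝ≥0) (c : Fin M → Fin n → ℝ)
    (u : Fin M) : Measurable (thresholdDecode Pt σ2 c u) := by
  have h1 : Measurable (uniqueOr u) := measurable_of_countable _
  refine h1.comp (measurable_pi_iff.2 fun i => ?_)
  refine measurableSet_setOfPred.1 (measurableSet_lt measurable_const ?_)
  unfold channelPDF outputPDF gaussianPDFReal
  fun_prop

/-- The code with codebook `c` and threshold decoding with fallback message `u`. -/
def thresholdCode {n M : ℕ} (m : ℕ) (Pt σ2 : ℝ≥0) (c : Fin M → Fin n → ℝ) (u : Fin M) :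
    EHCode m n M where
  encode w := transmit (c w)
  measurable_encode w := measurable_transmit (c w)
  feasible w := energyFeasible_transmit (c w)
  decode := thresholdDecode Pt σ2 c u
  measurable_decode := measurable_thresholdDecode Pt σ2 c u

/-- Probability of decoding error of the random Gaussian codebook with threshold decoding. The
codewords are independent with independent `N(0, Pt)` entries, message and fallback message are
uniform, and codebook, fallback, message, harvested energies and noise are independent. -/
def gaussianCodebookError (m n M : ℕ) (Pt PE σ2 : ℝ≥0) : ℝ :=
  (((Measure.pi fun _ : Fin M => iidGaussian n Pt).prod (uniformOn (Set.univ : Set (Fin M)))).prod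
      ((uniformOn (Set.univ : Set (Fin M))).prod
        ((harvestLaw m PE).prod (iidGaussian n σ2)))).real
    {p | thresholdDecode Pt σ2 p.1.1 p.1.2 (transmit (p.1.1 p.2.1) p.2.2.1 + p.2.2.2) ≠ p.2.1}

/-- The rate expression, in nats per channel use of the whole frame. -/
def ehRate (ε : ℝ) (m n : ℕ) (γ : ℝ) : ℝ :=
  ((n : ℝ) * Real.log (1 + γ) / 2 - √((2 + ε) / ε * (γ / (γ + 1)) * n)
    - (n : ℝ) ^ (1 / 4 : ℝ) - 1) / ((n : ℝ) + m)

end WPC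

end

namespace WPC

/-! Write `s² = (2+ε)/ε`, `q = γ/(1+γ)`, `F = n^(1/4)` and `L = log((2+ε)/ε²)`. If the rate
expression is not positive, `M = 1` works. Otherwise `M` is a rounded-up exponential, and the `-1`
in the rate pays for the rounding. Replacing the clipped sequence by the full codeword outside the
event that its total energy is not covered, a union bound leaves three terms
(`gaussianCodebookError_le`).

Outage: the exponential tail averaged over the Gaussian codeword is a Laplace transform, giving `1 -
(1+2a/m)^(-n/2)` (`measureReal_outage_le`).

Sent codeword below the threshold: the information density has variance `q` per letter and the
threshold lies at least `s√(nq)` below the mean, so Chebyshev gives `1/s² = ε/(2+ε)`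
(`measureReal_sum_letterInfo_add_le`).

Wrong codeword above the threshold: the usual change of measure is the Chernoff bound at parameter
`1` and gives `exp(-F)`, which is too weak for small `n`. The backoff `s√(nq)` makes a slightly
smaller parameter better and yields `5/3 · exp(-4s/5 - F)` (`mul_measureReal_passesThreshold_le`).

The three terms sum to at most `ε` (`error_sum_le`). For large `F` the wrong-codeword term is at
most `ε²/(2+ε)` and the bound on `n` limits the outage. For small `F` the bound on `m` makes the
outage at most `ε/4`. A deterministic code then exists because some value is at most the mean. -/

/-! ### Gaussian integrals and moments. -/

theorem integral_exp_neg_mul_sub_sq_gaussianReal {v : ℝ≥0} (hv : v ≠ 0) {b : ℝ}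
    (hb : 0 < 1 + 2 * b * v) (y : ℝ) :
    ∫ x, Real.exp (-b * (x - y) ^ 2) ∂gaussianReal 0 v =
      (√(1 + 2 * b * v))⁻¹ * Real.exp (-b * y ^ 2 / (1 + 2 * b * v)) := by
  have hv' : (0 : ℝ) < v := by positivity
  rw [integral_gaussianReal_eq_integral_smul hv]
  have h1 : ∀ x : ℝ, gaussianPDFReal 0 v x • Real.exp (-b * (x - y) ^ 2) =
      (√(2 * Real.pi * v))⁻¹ * Real.exp (-b * y ^ 2 / (1 + 2 * b * v)) *
        Real.exp (-((1 + 2 * b * v) / (2 * v)) * (x - 2 * b * v * y / (1 + 2 * b * v)) ^ 2) := by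
    intro x
    rw [gaussianPDFReal, smul_eq_mul, mul_assoc _ (Real.exp _), mul_assoc _ (Real.exp _),
      ← Real.exp_add, ← Real.exp_add]
    congr 2
    obtain ⟨D, hD⟩ : ∃ D, 1 + 2 * b * (v : ℝ) = D := ⟨_, rfl⟩
    rw [hD] at hb ⊢
    -- With `D` as the parameter, completing the square becomes an identity whose only denominators
    -- are `v` and `D`.
    obtain rfl : b = (D - 1) / (2 * v) := by field_simp; linarith
    field_simp
    ring
  simp_rw [h1]
  rw [integral_const_mul,
    integral_sub_right_eq_self (fun x : ℝ => Real.exp (-((1 + 2 * b * v) / (2 * v)) * x ^ 2)),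
    integral_gaussian, mul_right_comm]
  congr 1
  rw [← Real.sqrt_inv, ← Real.sqrt_inv, ← Real.sqrt_mul (by positivity)]
  congr 1
  have := Real.pi_ne_zero
  field_simp

/-- A non-integrable function has Bochner integral `0`, so the nonzero closed form already forces
integrability. -/
theorem integrable_exp_neg_mul_sub_sq_gaussianReal {v : ℝ≥0} (hv : v ≠ 0) {b : ℝ}
    (hb : 0 < 1 + 2 * b * v) (y : ℝ) :
    Integrable (fun x => Real.exp (-b * (x - y) ^ 2)) (gaussianReal 0 v) := by
  refine Integrable.of_integral_ne_zero ?_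
  rw [integral_exp_neg_mul_sub_sq_gaussianReal hv hb]
  positivity

section Moments

theorem integrable_pow_gaussianReal (μ : ℝ) (v : ℝ≥0) (k : ℕ) :
    Integrable (fun x => x ^ k) (gaussianReal μ v) := by
  have h := (memLp_id_gaussianReal (μ := μ) (v := v) k).integrable_norm_pow'
  exact h.mono' (by fun_prop) (by simp)

theorem integral_sq_gaussianReal (v : ℝ≥0) : ∫ x, x ^ 2 ∂gaussianReal 0 v = v := by
  have h := variance_fun_id_gaussianReal (μ := 0) (v := v)
  rw [variance_eq_integral measurable_id'.aemeasurable] at h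
  simpa using h

/-- Reduces moments of binary forms in two independent Gaussians to one-dimensional moments; used in
degree 2 for the mean and in degree 4 for the second moment of the information density. -/
theorem integral_form_prod_gaussianReal (u v : ℝ≥0) (d : ℕ) (c : ℕ → ℝ) :
    ∫ p : ℝ × ℝ, ∑ k ∈ Finset.range (d + 1), c k * (p.1 ^ (d - k) * p.2 ^ k)
        ∂((gaussianReal 0 u).prod (gaussianReal 0 v)) =
      ∑ k ∈ Finset.range (d + 1), c k *
        ((∫ x, x ^ (d - k) ∂gaussianReal 0 u) * ∫ x, x ^ k ∂gaussianReal 0 v) := by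
  rw [integral_finsetSum]
  · refine Finset.sum_congr rfl fun k _ => ?_
    rw [integral_const_mul, integral_prod_mul (fun x : ℝ => x ^ (d - k)) fun x : ℝ => x ^ k]
  · exact fun k _ => ((integrable_pow_gaussianReal 0 u _).mul_prod
      (integrable_pow_gaussianReal 0 v _)).const_mul _

theorem integral_add_pow_four_gaussianReal (v : ℝ≥0) :
    ∫ x, x ^ 4 ∂gaussianReal 0 (v + v) = 2 * ∫ x, x ^ 4 ∂gaussianReal 0 v + 6 * v ^ 2 := by
  have h0 := gaussianReal_conv_gaussianReal (m₁ := 0) (m₂ := 0) (v₁ := v) (v₂ := v)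
  rw [add_zero] at h0
  rw [← h0, Measure.conv, integral_map (by fun_prop) (by fun_prop)]
  have h1 := integral_form_prod_gaussianReal v v 4 fun k => (Nat.choose 4 k : ℝ)
  simp only [Finset.sum_range_succ, Finset.sum_range_zero, Nat.choose, Nat.reduceSub,
    pow_zero, pow_one, integral_id_gaussianReal, integral_sq_gaussianReal] at h1
  simp only [integral_const, probReal_univ, smul_eq_mul, one_mul, mul_one, mul_zero, zero_mul,
    zero_add, add_zero, Nat.reduceAdd, Nat.cast_ofNat, Nat.cast_one] at h1
  have h2 : ∀ p : ℝ × ℝ, (p.1 + p.2) ^ 4 = p.1 ^ 4 + 4 * (p.1 ^ 3 * p.2) +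
      6 * (p.1 ^ 2 * p.2 ^ 2) + 4 * (p.1 * p.2 ^ 3) + p.2 ^ 4 := fun p => by ring
  simp_rw [h2, h1]
  ring

/-- The fourth moment `μ₄` follows from stability: the sum of two independent copies has fourth
moment `2μ₄ + 6v²`, but it is also distributed as `√2` times one copy, so `4μ₄ = 2μ₄ + 6v²`. -/
theorem integral_pow_four_gaussianReal (v : ℝ≥0) :
    ∫ x, x ^ 4 ∂gaussianReal 0 v = 3 * v ^ 2 := by
  have h1 := integral_add_pow_four_gaussianReal v
  have h2 : gaussianReal 0 (v + v) = (gaussianReal 0 v).map (√2 * ·) := by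
    rw [gaussianReal_map_const_mul]
    congr 1
    · simp
    · ext; simp; ring
  rw [h2, integral_map (by fun_prop) (by fun_prop)] at h1
  simp only [mul_pow, integral_const_mul] at h1
  have h3 : √2 ^ 4 = (4 : ℝ) := by
    rw [show √2 ^ 4 = (√2 ^ 2) ^ 2 by ring, Real.sq_sqrt (by norm_num)]; norm_num
  rw [h3] at h1
  linarith

end Moments

/-! ### Information density and its tail bounds. -/

/-- The information density of a single letter, up to its mean `log (1 + Pt / σ2) / 2`. -/
noncomputable def letterInfo (Pt σ2 : ℝ≥0) (x y : ℝ) : ℝ :=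
  y ^ 2 / (2 * (Pt + σ2)) - (y - x) ^ 2 / (2 * σ2)

theorem measurable_letterInfo (Pt σ2 : ℝ≥0) :
    Measurable fun p : ℝ × ℝ => letterInfo Pt σ2 p.1 p.2 := by
  unfold letterInfo
  fun_prop

theorem log_channelPDF_div_outputPDF {n : ℕ} {Pt σ2 : ℝ≥0} (hσ2 : 0 < σ2) (x y : Fin n → ℝ) :
    Real.log (channelPDF σ2 x y / outputPDF Pt σ2 y) =
      n * (Real.log (1 + Pt / σ2) / 2) + ∑ l, letterInfo Pt σ2 (x l) (y l) := by
  have hS : 0 < Pt + σ2 := by positivity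
  have hσ : (0 : ℝ) < σ2 := hσ2
  have hlog : ∀ (μ : ℝ) (v : ℝ≥0) (z : ℝ), 0 < v → Real.log (gaussianPDFReal μ v z) =
      -(Real.log (2 * Real.pi * v) / 2) + -(z - μ) ^ 2 / (2 * v) := by
    intro μ v z hv
    have hv' : (0 : ℝ) < v := hv
    rw [gaussianPDFReal, Real.log_mul (by positivity) (by positivity), Real.log_exp, Real.log_inv,
      Real.log_sqrt (by positivity)]
  rw [channelPDF, outputPDF, ← Finset.prod_div_distrib, Real.log_prod]
  · have h1 : ∀ l, Real.log (gaussianPDFReal (x l) σ2 (y l) / gaussianPDFReal 0 (Pt + σ2) (y l)) =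
        Real.log (1 + Pt / σ2) / 2 + letterInfo Pt σ2 (x l) (y l) := by
      intro l
      rw [Real.log_div (gaussianPDFReal_pos _ _ _ hσ2.ne').ne' (gaussianPDFReal_pos _ _ _ hS.ne').ne',
        hlog _ _ _ hσ2, hlog _ _ _ hS, show 1 + (Pt : ℝ) / σ2 =
          2 * Real.pi * ((Pt + σ2 : ℝ≥0) : ℝ) / (2 * Real.pi * σ2) by
          have := Real.pi_ne_zero; push_cast; field_simp; ring,
        Real.log_div (by positivity) (by positivity), letterInfo]
      push_cast
      ring
    simp_rw [h1]
    rw [Finset.sum_add_distrib]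
    simp
  · intro l _
    exact (div_pos (gaussianPDFReal_pos _ _ _ hσ2.ne') (gaussianPDFReal_pos _ _ _ hS.ne')).ne'

theorem passesThreshold_iff {n : ℕ} {Pt σ2 : ℝ≥0} (hσ2 : 0 < σ2) (M : ℕ) (x y : Fin n → ℝ) :
    PassesThreshold Pt σ2 M x y ↔ Real.log M + (n : ℝ) ^ (1 / 4 : ℝ) -
      n * (Real.log (1 + Pt / σ2) / 2) < ∑ l, letterInfo Pt σ2 (x l) (y l) := by
  rw [PassesThreshold, log_channelPDF_div_outputPDF hσ2, sub_lt_iff_lt_add']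

instance (n : ℕ) (v : ℝ≥0) : IsProbabilityMeasure (iidGaussian n v) := by
  unfold iidGaussian; infer_instance

theorem measurePreserving_arrowProd_iidGaussian (n : ℕ) (u v : ℝ≥0) :
    MeasurePreserving (MeasurableEquiv.arrowProdEquivProdArrow ℝ ℝ (Fin n))
      (Measure.pi fun _ => (gaussianReal 0 u).prod (gaussianReal 0 v))
      ((iidGaussian n u).prod (iidGaussian n v)) :=
  measurePreserving_arrowProdEquivProdArrow ℝ ℝ (Fin n) _ _

theorem measurePreserving_add_iidGaussian (n : ℕ) (u v : ℝ≥0) :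
    MeasurePreserving (fun p : (Fin n → ℝ) × (Fin n → ℝ) => p.1 + p.2)
      ((iidGaussian n u).prod (iidGaussian n v)) (iidGaussian n (u + v)) := by
  have h1 : MeasurePreserving (fun p : ℝ × ℝ => p.1 + p.2)
      ((gaussianReal 0 u).prod (gaussianReal 0 v)) (gaussianReal 0 (u + v)) := by
    refine ⟨by fun_prop, ?_⟩
    have := gaussianReal_conv_gaussianReal (m₁ := 0) (m₂ := 0) (v₁ := u) (v₂ := v)
    rwa [add_zero] at this
  exact (measurePreserving_pi _ _ fun _ : Fin n => h1).comp
    (measurePreserving_arrowProd_iidGaussian n u v).symm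

/-- The exponential moment of the information density under independent input and output. -/
theorem integral_exp_letterInfo {Pt σ2 : ℝ≥0} (hPt : 0 < Pt) (hσ2 : 0 < σ2) {θ : ℝ}
    (h0 : 0 ≤ θ) (h1 : θ ≤ 1) :
    Integrable (fun p : ℝ × ℝ => Real.exp (θ * letterInfo Pt σ2 p.1 p.2))
      ((gaussianReal 0 Pt).prod (gaussianReal 0 (Pt + σ2))) ∧
    ∫ p : ℝ × ℝ, Real.exp (θ * letterInfo Pt σ2 p.1 p.2)
        ∂((gaussianReal 0 Pt).prod (gaussianReal 0 (Pt + σ2))) =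
      (√(1 + 2 * θ * (Pt / σ2) - θ ^ 2 * (Pt / σ2)))⁻¹ := by
  have hP : (0 : ℝ) < Pt := hPt
  have hσ : (0 : ℝ) < σ2 := hσ2
  have hS : 0 < Pt + σ2 := by positivity
  set b : ℝ := θ / (2 * σ2) with hb
  have hbP : 0 < 1 + 2 * b * Pt := by positivity
  -- Integrating out `x` leaves a Gaussian exponential in `y` with coefficient `b'`, so the same
  -- one-dimensional formula applies a second time; `hD` multiplies the two resulting factors.
  set b' : ℝ := b / (1 + 2 * b * Pt) - θ / (2 * (Pt + σ2)) with hb'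
  have hD : (1 + 2 * b * Pt) * (1 + 2 * b' * ((Pt + σ2 : ℝ≥0) : ℝ)) =
      1 + 2 * θ * (Pt / σ2) - θ ^ 2 * (Pt / σ2) := by
    have : σ2 + θ * Pt ≠ (0 : ℝ) := by positivity
    rw [hb', hb]
    push_cast
    field_simp
    ring
  have hDpos : 0 < 1 + 2 * θ * (Pt / σ2) - θ ^ 2 * ((Pt : ℝ) / σ2) := by
    have : 0 ≤ θ * (2 - θ) * ((Pt : ℝ) / σ2) := by
      have : 0 ≤ 2 - θ := by linarith
      positivity
    nlinarith
  have hbS : 0 < 1 + 2 * b' * ((Pt + σ2 : ℝ≥0) : ℝ) := by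
    rw [← hD] at hDpos
    exact (mul_pos_iff_of_pos_left hbP).1 hDpos
  have hf : ∀ x y : ℝ, Real.exp (θ * letterInfo Pt σ2 x y) =
      Real.exp (θ * y ^ 2 / (2 * (Pt + σ2))) * Real.exp (-b * (x - y) ^ 2) := by
    intro x y
    rw [← Real.exp_add, letterInfo, hb]
    congr 1
    ring
  have hx : ∀ y : ℝ, Integrable (fun x => Real.exp (θ * letterInfo Pt σ2 x y))
      (gaussianReal 0 Pt) := by
    intro y
    simp_rw [hf]
    exact (integrable_exp_neg_mul_sub_sq_gaussianReal hPt.ne' hbP y).const_mul _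
  have hxI : ∀ y : ℝ, ∫ x, Real.exp (θ * letterInfo Pt σ2 x y) ∂gaussianReal 0 Pt =
      (√(1 + 2 * b * Pt))⁻¹ * Real.exp (-b' * (y - 0) ^ 2) := by
    intro y
    simp_rw [hf]
    rw [integral_const_mul, integral_exp_neg_mul_sub_sq_gaussianReal hPt.ne' hbP, mul_left_comm,
      ← Real.exp_add, hb']
    congr 2
    ring
  have hint : Integrable (fun p : ℝ × ℝ => Real.exp (θ * letterInfo Pt σ2 p.1 p.2))
      ((gaussianReal 0 Pt).prod (gaussianReal 0 (Pt + σ2))) := by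
    rw [integrable_prod_iff'
      ((measurable_letterInfo Pt σ2).const_mul θ).exp.aestronglyMeasurable]
    refine ⟨Filter.Eventually.of_forall hx, ?_⟩
    simp_rw [Real.norm_eq_abs, Real.abs_exp, hxI]
    exact (integrable_exp_neg_mul_sub_sq_gaussianReal hS.ne' hbS 0).const_mul _
  refine ⟨hint, ?_⟩
  rw [integral_prod_symm _ hint]
  simp_rw [hxI]
  rw [integral_const_mul, integral_exp_neg_mul_sub_sq_gaussianReal hS.ne' hbS, ← hD,
    Real.sqrt_mul hbP.le, mul_inv]
  simp

theorem measurableSet_lt_sum_letterInfo (n : ℕ) (Pt σ2 : ℝ≥0) (t : ℝ) :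
    MeasurableSet {p : (Fin n → ℝ) × (Fin n → ℝ) | t < ∑ l, letterInfo Pt σ2 (p.1 l) (p.2 l)} := by
  refine measurableSet_lt measurable_const (Finset.measurable_sum _ fun l _ => ?_)
  unfold letterInfo
  fun_prop

/-- Chernoff bound for a wrong codeword. -/
theorem measureReal_lt_sum_letterInfo_le {Pt σ2 : ℝ≥0} (hPt : 0 < Pt) (hσ2 : 0 < σ2) {θ : ℝ}
    (h0 : 0 ≤ θ) (h1 : θ ≤ 1) (n : ℕ) (t : ℝ) :
    ((iidGaussian n Pt).prod (iidGaussian n (Pt + σ2))).real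
      {p | t < ∑ l, letterInfo Pt σ2 (p.1 l) (p.2 l)} ≤
      Real.exp (-θ * t) * (√(1 + 2 * θ * (Pt / σ2) - θ ^ 2 * (Pt / σ2)))⁻¹ ^ n := by
  have hmp := measurePreserving_arrowProd_iidGaussian n Pt (Pt + σ2)
  obtain ⟨hint, hI⟩ := integral_exp_letterInfo hPt hσ2 h0 h1
  rw [← hmp.measureReal_preimage (measurableSet_lt_sum_letterInfo n Pt σ2 t).nullMeasurableSet]
  set X : (Fin n → ℝ × ℝ) → ℝ := fun p => ∑ l, letterInfo Pt σ2 (p l).1 (p l).2 with hX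
  have hexp : ∀ p, Real.exp (θ * X p) = ∏ l, Real.exp (θ * letterInfo Pt σ2 (p l).1 (p l).2) := by
    intro p
    rw [hX, ← Real.exp_sum, Finset.mul_sum]
  have h2 := measure_ge_le_exp_mul_mgf (μ := Measure.pi fun _ : Fin n =>
    (gaussianReal 0 Pt).prod (gaussianReal 0 (Pt + σ2))) (X := X) t h0 (by
      simp_rw [hexp]
      exact Integrable.fintype_prod fun _ => hint)
  have h3 : mgf X (Measure.pi fun _ : Fin n =>
      (gaussianReal 0 Pt).prod (gaussianReal 0 (Pt + σ2))) θ =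
      (√(1 + 2 * θ * (Pt / σ2) - θ ^ 2 * (Pt / σ2)))⁻¹ ^ n := by
    rw [mgf]
    simp_rw [hexp]
    rw [integral_fintype_prod_eq_pow (fun p : ℝ × ℝ => Real.exp (θ * letterInfo Pt σ2 p.1 p.2)), hI,
      Fintype.card_fin]
  rw [h3] at h2
  refine le_trans (measureReal_mono ?_) h2
  intro p hp
  have hp' : t < X p := hp
  exact hp'.le

theorem letterInfo_add (Pt σ2 : ℝ≥0) (x v : ℝ) : letterInfo Pt σ2 x (x + v) =
    (x + v) ^ 2 / (2 * (Pt + σ2)) - v ^ 2 / (2 * σ2) := by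
  rw [letterInfo, add_sub_cancel_left]

theorem integral_letterInfo_add {Pt σ2 : ℝ≥0} (hσ2 : 0 < σ2) :
    ∫ p : ℝ × ℝ, letterInfo Pt σ2 p.1 (p.1 + p.2) ∂((gaussianReal 0 Pt).prod (gaussianReal 0 σ2)) =
      0 := by
  have hσ : (0 : ℝ) < σ2 := hσ2
  set A : ℝ := 1 / (2 * (Pt + σ2)) with hA
  set B : ℝ := A - 1 / (2 * σ2) with hB
  -- Coefficients of `letterInfo` at `(x, x + v)` as a quadratic form in `x` and `v`.
  have h1 := integral_form_prod_gaussianReal Pt σ2 2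
    fun k => match k with | 0 => A | 1 => 2 * A | _ => B
  simp only [Finset.sum_range_succ, Finset.sum_range_zero, Nat.reduceSub,
    pow_zero, pow_one, integral_id_gaussianReal, integral_sq_gaussianReal] at h1
  simp only [integral_const, probReal_univ, smul_eq_mul, one_mul, mul_one, mul_zero,
    zero_add, add_zero] at h1
  have h2 : ∀ p : ℝ × ℝ, letterInfo Pt σ2 p.1 (p.1 + p.2) =
      A * p.1 ^ 2 + 2 * A * (p.1 * p.2) + B * p.2 ^ 2 := fun p => by
    rw [letterInfo_add, hB, hA]; ring
  simp_rw [h2, h1, hB, hA]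
  field_simp
  ring

theorem integral_letterInfo_add_sq {Pt σ2 : ℝ≥0} (hσ2 : 0 < σ2) :
    ∫ p : ℝ × ℝ, letterInfo Pt σ2 p.1 (p.1 + p.2) ^ 2
      ∂((gaussianReal 0 Pt).prod (gaussianReal 0 σ2)) = Pt / (Pt + σ2) := by
  have hσ : (0 : ℝ) < σ2 := hσ2
  set A : ℝ := 1 / (2 * (Pt + σ2)) with hA
  set B : ℝ := A - 1 / (2 * σ2) with hB
  have h1 := integral_form_prod_gaussianReal Pt σ2 4
    fun k => match k with
      | 0 => A ^ 2 | 1 => 4 * A ^ 2 | 2 => 4 * A ^ 2 + 2 * A * B | 3 => 4 * A * B | _ => B ^ 2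
  simp only [Finset.sum_range_succ, Finset.sum_range_zero, Nat.reduceSub,
    pow_zero, pow_one, integral_id_gaussianReal, integral_sq_gaussianReal,
    integral_pow_four_gaussianReal] at h1
  simp only [integral_const, probReal_univ, smul_eq_mul, one_mul, mul_one, mul_zero, zero_mul,
    zero_add, add_zero] at h1
  have h2 : ∀ p : ℝ × ℝ, letterInfo Pt σ2 p.1 (p.1 + p.2) ^ 2 =
      A ^ 2 * p.1 ^ 4 + 4 * A ^ 2 * (p.1 ^ 3 * p.2) +
        (4 * A ^ 2 + 2 * A * B) * (p.1 ^ 2 * p.2 ^ 2) + 4 * A * B * (p.1 * p.2 ^ 3) +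
        B ^ 2 * p.2 ^ 4 := fun p => by
    rw [letterInfo_add, hB, hA]; ring
  simp_rw [h2, h1, hB, hA]
  field_simp
  ring

theorem memLp_letterInfo_add {Pt σ2 : ℝ≥0} (hPt : 0 < Pt) (hσ2 : 0 < σ2) :
    MemLp (fun p : ℝ × ℝ => letterInfo Pt σ2 p.1 (p.1 + p.2)) 2
      ((gaussianReal 0 Pt).prod (gaussianReal 0 σ2)) := by
  have hP : (0 : ℝ) < Pt := hPt
  have hσ : (0 : ℝ) < σ2 := hσ2
  have hm : Measurable fun p : ℝ × ℝ => letterInfo Pt σ2 p.1 (p.1 + p.2) := by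
    unfold letterInfo
    fun_prop
  rw [memLp_two_iff_integrable_sq hm.aestronglyMeasurable]
  refine Integrable.of_integral_ne_zero ?_
  rw [integral_letterInfo_add_sq hσ2]
  positivity

/-- Chebyshev bound for the transmitted codeword. -/
theorem measureReal_sum_letterInfo_add_le {Pt σ2 : ℝ≥0} (hPt : 0 < Pt) (hσ2 : 0 < σ2) (n : ℕ)
    {D : ℝ} (hD : 0 < D) :
    ((iidGaussian n Pt).prod (iidGaussian n σ2)).real
      {p | ∑ l, letterInfo Pt σ2 (p.1 l) ((p.1 + p.2) l) ≤ -D} ≤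
      n * (Pt / (Pt + σ2)) / D ^ 2 := by
  have hmp := measurePreserving_arrowProd_iidGaussian n Pt σ2
  have hms : MeasurableSet {p : (Fin n → ℝ) × (Fin n → ℝ) |
      ∑ l, letterInfo Pt σ2 (p.1 l) ((p.1 + p.2) l) ≤ -D} := by
    refine measurableSet_le (Finset.measurable_sum _ fun l _ => ?_) measurable_const
    unfold letterInfo
    fun_prop
  rw [← hmp.measureReal_preimage hms.nullMeasurableSet]
  set Y : ℝ × ℝ → ℝ := fun p => letterInfo Pt σ2 p.1 (p.1 + p.2) with hY
  set X : (Fin n → ℝ × ℝ) → ℝ := ∑ l, fun p => Y (p l) with hX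
  set μ := (gaussianReal 0 Pt).prod (gaussianReal 0 σ2) with hμ
  have hYL : MemLp Y 2 μ := memLp_letterInfo_add hPt hσ2
  have hYl : ∀ l : Fin n, MemLp (fun p : Fin n → ℝ × ℝ => Y (p l)) 2 (Measure.pi fun _ => μ) :=
    fun l => hYL.comp_measurePreserving (measurePreserving_eval (fun _ : Fin n => μ) l)
  have hXL : MemLp X 2 (Measure.pi fun _ => μ) := memLp_finsetSum' _ fun l _ => hYl l
  have hvar : variance X (Measure.pi fun _ => μ) = n * (Pt / (Pt + σ2)) := by
    rw [hX, variance_sum_pi (X := fun _ : Fin n => Y) fun _ => hYL]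
    rw [variance_of_integral_eq_zero hYL.aestronglyMeasurable.aemeasurable
      (integral_letterInfo_add hσ2), integral_letterInfo_add_sq hσ2]
    simp
  have hmean : ∫ p, X p ∂(Measure.pi fun _ => μ) = 0 := by
    simp only [hX, Finset.sum_apply]
    rw [integral_finsetSum _ fun l _ => (hYl l).integrable (by norm_num)]
    refine Finset.sum_eq_zero fun l _ => ?_
    have hev := (measurePreserving_eval (fun _ : Fin n => μ) l).map_eq
    have h1 := integral_map (μ := Measure.pi fun _ : Fin n => μ) (measurable_pi_apply l).aemeasurable
      (f := Y) (hev.symm ▸ hYL.aestronglyMeasurable)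
    refine h1.symm.trans ?_
    rw [show Measure.map (fun p : Fin n → ℝ × ℝ => p l) (Measure.pi fun _ => μ) = μ from hev]
    exact integral_letterInfo_add hσ2
  have h := meas_ge_le_variance_div_sq hXL hD
  rw [hvar, hmean] at h
  refine ENNReal.toReal_le_of_le_ofReal (by positivity) (le_trans (measure_mono ?_) h)
  intro p hp
  have hp' : X p ≤ -D := by
    rw [hX, Finset.sum_apply]
    exact hp
  change D ≤ |X p - 0|
  rw [sub_zero, abs_of_nonpos (by linarith)]
  linarith

/-! ### Energy outage. -/

theorem isProbabilityMeasure_harvestLaw (m : ℕ) {PE : ℝ≥0} (hPE : 0 < PE) :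
    IsProbabilityMeasure (harvestLaw m PE) := by
  have : IsProbabilityMeasure (expMeasure (PE : ℝ)⁻¹) :=
    isProbabilityMeasure_expMeasure (by positivity)
  exact Measure.isProbabilityMeasure_map (by fun_prop)

theorem measurableSet_sum_lt_sum_sq (m n : ℕ) :
    MeasurableSet {p : (Fin n → ℝ) × (Fin m → ℝ) | ∑ i, p.2 i < ∑ l, p.1 l ^ 2} :=
  measurableSet_lt (by fun_prop) (by fun_prop)

/-- The probability that the harvested energy does not suffice for a Gaussian codeword. -/
theorem measureReal_outage_le {m : ℕ} (hm : 0 < m) (n : ℕ) {Pt PE : ℝ≥0} (hPt : 0 < Pt)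
    (hPE : 0 < PE) :
    ((iidGaussian n Pt).prod (harvestLaw m PE)).real {p | ∑ i, p.2 i < ∑ l, p.1 l ^ 2} ≤
      1 - (√(1 + 2 * (Pt / PE) / m))⁻¹ ^ n := by
  have hP : (0 : ℝ) < Pt := hPt
  have hE : (0 : ℝ) < PE := hPE
  have hm' : (0 : ℝ) < m := by exact_mod_cast hm
  have hE' : (0 : ℝ) < (PE : ℝ)⁻¹ := by positivity
  have : IsProbabilityMeasure (expMeasure (PE : ℝ)⁻¹) := isProbabilityMeasure_expMeasure hE'
  have : IsProbabilityMeasure (harvestLaw m PE) := isProbabilityMeasure_harvestLaw m hPE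
  have hconst : MeasurePreserving (fun (z : ℝ) (_ : Fin m) => z) (expMeasure (PE : ℝ)⁻¹)
      (harvestLaw m PE) := ⟨by fun_prop, rfl⟩
  have hmp := (MeasurePreserving.id (iidGaussian n Pt)).prod hconst
  rw [← hmp.measureReal_preimage (measurableSet_sum_lt_sum_sq m n).nullMeasurableSet]
  -- The harvested total is `m` times one exponential variable, so for a fixed codeword `x` the
  -- energy suffices with probability `exp (-b * ∑ x l ^ 2)`, which factors over the letters.
  set b : ℝ := (PE : ℝ)⁻¹ / m with hb
  have hg : ∀ x : Fin n → ℝ, Real.exp (-b * ∑ l, x l ^ 2) =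
      ∏ l, Real.exp (-b * (x l - 0) ^ 2) := by
    intro x
    rw [← Real.exp_sum, Finset.mul_sum]
    simp
  have hbv : 0 < 1 + 2 * b * (Pt : ℝ) := by positivity
  have hgi : Integrable (fun x : Fin n → ℝ => Real.exp (-b * ∑ l, x l ^ 2))
      (iidGaussian n Pt) := by
    simp_rw [hg]
    exact Integrable.fintype_prod fun _ =>
      integrable_exp_neg_mul_sub_sq_gaussianReal hPt.ne' hbv 0
  have hgI : ∫ x : Fin n → ℝ, Real.exp (-b * ∑ l, x l ^ 2) ∂iidGaussian n Pt =
      (√(1 + 2 * (Pt / PE) / m))⁻¹ ^ n := by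
    simp_rw [hg]
    rw [iidGaussian, integral_fintype_prod_eq_pow (fun x : ℝ => Real.exp (-b * (x - 0) ^ 2)),
      integral_exp_neg_mul_sub_sq_gaussianReal hPt.ne' hbv, Fintype.card_fin,
      show 1 + 2 * b * (Pt : ℝ) = 1 + 2 * (Pt / PE) / m by rw [hb]; field_simp]
    simp
  have hle : ∀ x : Fin n → ℝ, Real.exp (-b * ∑ l, x l ^ 2) ≤ 1 := by
    intro x
    rw [Real.exp_le_one_iff, neg_mul, neg_nonpos]
    have : 0 ≤ ∑ l, x l ^ 2 := Finset.sum_nonneg fun _ _ => sq_nonneg _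
    positivity
  have hfin : ((iidGaussian n Pt).prod (expMeasure (PE : ℝ)⁻¹))
      (Prod.map id (fun (z : ℝ) (_ : Fin m) => z) ⁻¹'
        {p : (Fin n → ℝ) × (Fin m → ℝ) | ∑ i, p.2 i < ∑ l, p.1 l ^ 2}) ≤
      ENNReal.ofReal (1 - (√(1 + 2 * (Pt / PE) / m))⁻¹ ^ n) := by
    rw [Measure.prod_apply (hmp.measurable (measurableSet_sum_lt_sum_sq m n))]
    calc _ ≤ ∫⁻ x, ENNReal.ofReal (1 - Real.exp (-b * ∑ l, x l ^ 2)) ∂iidGaussian n Pt := by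
          refine lintegral_mono fun x => ?_
          have hcdf := cdf_expMeasure_eq hE' ((∑ l, x l ^ 2) / m)
          rw [if_pos (by positivity)] at hcdf
          rw [show -b * ∑ l, x l ^ 2 = -((PE : ℝ)⁻¹ * ((∑ l, x l ^ 2) / m)) by rw [hb]; ring,
            ← hcdf, ofReal_cdf]
          refine measure_mono fun z hz => ?_
          have hz' : ∑ _i : Fin m, z < ∑ l, x l ^ 2 := hz
          rw [Finset.sum_const, Finset.card_univ, Fintype.card_fin, nsmul_eq_mul] at hz'
          rw [Set.mem_Iic, le_div_iff₀ hm']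
          linarith
      _ = ENNReal.ofReal (∫ x, (1 - Real.exp (-b * ∑ l, x l ^ 2)) ∂iidGaussian n Pt) :=
          (ofReal_integral_eq_lintegral_ofReal ((integrable_const 1).sub hgi)
            (Filter.Eventually.of_forall fun x => sub_nonneg.2 (hle x))).symm
      _ = _ := by
          rw [integral_sub (integrable_const 1) hgi, hgI]
          simp
  refine ENNReal.toReal_le_of_le_ofReal ?_ hfin
  rw [← hgI, sub_nonneg]
  calc _ ≤ ∫ _x, (1 : ℝ) ∂iidGaussian n Pt := integral_mono hgi (integrable_const 1) hle
    _ = 1 := by simp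

/-! ### Decoding errors and the union bound. -/

theorem transmit_eq_of_sum_sq_le {m n : ℕ} {x : Fin n → ℝ} {z : Fin m → ℝ}
    (h : ∑ l, x l ^ 2 ≤ ∑ i, z i) : transmit x z = x := by
  funext l
  rw [transmit, if_pos]
  exact (Finset.sum_le_univ_sum_of_nonneg fun _ => sq_nonneg _).trans h

theorem uniqueOr_eq {M : ℕ} (u : Fin M) {S : Fin M → Prop} {w : Fin M} (hw : S w)
    (h : ∀ i, S i → i = w) : uniqueOr u S = w := by
  have hex : ∃! i, S i := ⟨w, hw, h⟩
  rw [uniqueOr, dif_pos hex]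
  exact h _ hex.exists.choose_spec

/-- A decoding error is caused by an energy outage, by the transmitted codeword failing the
threshold test, or by another codeword passing it. -/
theorem error_cases {m n M : ℕ} {Pt σ2 : ℝ≥0} {c : Fin M → Fin n → ℝ} {u w : Fin M}
    {z : Fin m → ℝ} {v : Fin n → ℝ}
    (h : thresholdDecode Pt σ2 c u (transmit (c w) z + v) ≠ w) :
    ∑ i, z i < ∑ l, c w l ^ 2 ∨ ¬ PassesThreshold Pt σ2 M (c w) (c w + v) ∨
      ∃ i, i ≠ w ∧ PassesThreshold Pt σ2 M (c i) (c w + v) := by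
  by_contra! hcon
  obtain ⟨h1, h2, h3⟩ := hcon
  rw [transmit_eq_of_sum_sq_le h1] at h
  exact h (uniqueOr_eq u h2 fun i hi => by_contra fun hne => h3 i hne hi)

theorem measurableSet_passesThreshold (n : ℕ) (Pt σ2 : ℝ≥0) (M : ℕ) :
    MeasurableSet {p : (Fin n → ℝ) × (Fin n → ℝ) | PassesThreshold Pt σ2 M p.1 p.2} := by
  refine measurableSet_lt measurable_const ?_
  unfold channelPDF outputPDF gaussianPDFReal
  fun_prop

theorem measurableSet_passesThreshold_add (n : ℕ) (Pt σ2 : ℝ≥0) (M : ℕ) :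
    MeasurableSet {p : (Fin n → ℝ) × (Fin n → ℝ) | PassesThreshold Pt σ2 M p.1 (p.1 + p.2)} :=
  (measurable_fst.prodMk (measurable_fst.add measurable_snd)) (measurableSet_passesThreshold n Pt σ2 M)

section Uniform

theorem isProbabilityMeasure_uniformOn_univ {M : ℕ} (hM : 0 < M) :
    IsProbabilityMeasure (uniformOn (Set.univ : Set (Fin M))) :=
  have : NeZero M := ⟨hM.ne'⟩
  isProbabilityMeasure_uniformOn Set.finite_univ Set.univ_nonempty

variable {α β : Type*} [MeasurableSpace α] [MeasurableSpace β]

/-- A bound that holds for every value of the message holds on average. -/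
theorem prod_uniformOn_prod_le {M : ℕ} (hM : 0 < M) (μ : Measure α) (ν : Measure β)
    [IsProbabilityMeasure μ] [IsProbabilityMeasure ν] (E : Fin M → Set (α × β))
    (hE : ∀ w, MeasurableSet (E w)) {b : ENNReal} (h : ∀ w, (μ.prod ν) (E w) ≤ b) :
    ((μ.prod (uniformOn (Set.univ : Set (Fin M)))).prod
      ((uniformOn (Set.univ : Set (Fin M))).prod ν)) {p | (p.1.1, p.2.2) ∈ E p.2.1} ≤ b := by
  have := isProbabilityMeasure_uniformOn_univ hM
  set U := uniformOn (Set.univ : Set (Fin M))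
  have h1 : MeasurePreserving (fun p : (α × Fin M) × Fin M × β => (p.1.1, p.2))
      ((μ.prod U).prod (U.prod ν)) (μ.prod (U.prod ν)) :=
    measurePreserving_fst.prod (MeasurePreserving.id _)
  have h2 : MeasurePreserving (fun p : Fin M × α × β => (p.2.1, p.1, p.2.2))
      (U.prod (μ.prod ν)) (μ.prod (U.prod ν)) := by
    have h3 := (measurePreserving_prodAssoc U μ ν).symm
    have h4 := (Measure.measurePreserving_swap (μ := U) (ν := μ)).prod (MeasurePreserving.id ν)
    exact (measurePreserving_prodAssoc μ U ν).comp (h4.comp h3)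
  have hS : MeasurableSet {q : Fin M × α × β | q.2 ∈ E q.1} := by
    have : {q : Fin M × α × β | q.2 ∈ E q.1} = ⋃ w, {w} ×ˢ E w := by
      ext q; simp
    rw [this]
    exact MeasurableSet.iUnion fun w => (measurableSet_singleton w).prod (hE w)
  have hT : MeasurableSet {q : α × Fin M × β | (q.1, q.2.2) ∈ E q.2.1} :=
    (measurable_snd.fst.prodMk (measurable_fst.prodMk measurable_snd.snd)) hS
  calc _ = (μ.prod (U.prod ν)) {q | (q.1, q.2.2) ∈ E q.2.1} :=
        h1.measure_preimage hT.nullMeasurableSet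
    _ = (U.prod (μ.prod ν)) {q | q.2 ∈ E q.1} := (h2.measure_preimage hT.nullMeasurableSet).symm
    _ = ∫⁻ w, (μ.prod ν) (E w) ∂U := Measure.prod_apply hS
    _ ≤ ∫⁻ _w, b ∂U := lintegral_mono h
    _ = b := by simp

end Uniform

/-- Two distinct codewords are independent; hence a wrong codeword is independent of the channel
output. -/
theorem measurePreserving_eval_pair {M : ℕ} {E : Type*} [MeasurableSpace E] (μ : Measure E)
    [IsProbabilityMeasure μ] {i w : Fin M} (h : i ≠ w) :
    MeasurePreserving (fun c : Fin M → E => (c i, c w)) (Measure.pi fun _ => μ) (μ.prod μ) := by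
  have hind := (iIndepFun_pi (μ := fun _ : Fin M => μ) (X := fun _ => id)
    fun _ => aemeasurable_id).indepFun h
  simp only [id_eq] at hind
  rw [indepFun_iff_map_prod_eq_prod_map_map (measurable_pi_apply i).aemeasurable
    (measurable_pi_apply w).aemeasurable] at hind
  refine ⟨by fun_prop, hind.trans ?_⟩
  congr 1
  · exact (measurePreserving_eval (fun _ : Fin M => μ) i).map_eq
  · exact (measurePreserving_eval (fun _ : Fin M => μ) w).map_eq

theorem gaussianCodebookError_le {m n M : ℕ} (hM : 0 < M) (Pt σ2 : ℝ≥0) {PE : ℝ≥0} (hPE : 0 < PE) :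
    gaussianCodebookError m n M Pt PE σ2 ≤
      ((iidGaussian n Pt).prod (harvestLaw m PE)).real {p | ∑ i, p.2 i < ∑ l, p.1 l ^ 2} +
      ((iidGaussian n Pt).prod (iidGaussian n σ2)).real
        {p | ¬ PassesThreshold Pt σ2 M p.1 (p.1 + p.2)} +
      M * ((iidGaussian n Pt).prod (iidGaussian n (Pt + σ2))).real
        {p | PassesThreshold Pt σ2 M p.1 p.2} := by
  have := isProbabilityMeasure_uniformOn_univ hM
  have := isProbabilityMeasure_harvestLaw m hPE
  set Q := Measure.pi fun _ : Fin M => iidGaussian n Pt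
  set N := iidGaussian n σ2
  set H := harvestLaw m PE
  set μ := iidGaussian n Pt
  have hO := measurableSet_sum_lt_sum_sq m n
  have hA := measurableSet_passesThreshold_add n Pt σ2 M
  have hA' := measurableSet_passesThreshold n Pt σ2 M
  let E1 : Fin M → Set ((Fin M → Fin n → ℝ) × (Fin m → ℝ) × (Fin n → ℝ)) := fun w =>
    {p | ∑ i, p.2.1 i < ∑ l, p.1 w l ^ 2}
  let E2 : Fin M → Set ((Fin M → Fin n → ℝ) × (Fin m → ℝ) × (Fin n → ℝ)) := fun w =>
    {p | ¬ PassesThreshold Pt σ2 M (p.1 w) (p.1 w + p.2.2)}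
  let E3 : Fin M → Fin M → Set ((Fin M → Fin n → ℝ) × (Fin m → ℝ) × (Fin n → ℝ)) := fun w i =>
    {p | i ≠ w ∧ PassesThreshold Pt σ2 M (p.1 i) (p.1 w + p.2.2)}
  have hE1m : ∀ w, MeasurableSet (E1 w) := fun w => measurableSet_lt (by fun_prop) (by fun_prop)
  have hE2m : ∀ w, MeasurableSet (E2 w) := fun w =>
    (show Measurable fun p : (Fin M → Fin n → ℝ) × (Fin m → ℝ) × (Fin n → ℝ) =>
      (p.1 w, p.2.2) by fun_prop) hA.compl
  have hE3m : ∀ w i, MeasurableSet (E3 w i) := fun w i =>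
    (MeasurableSet.const (i ≠ w)).inter
      ((show Measurable fun p : (Fin M → Fin n → ℝ) × (Fin m → ℝ) × (Fin n → ℝ) =>
        (p.1 i, p.1 w + p.2.2) by fun_prop) hA')
  have hE1 : ∀ w, (Q.prod (H.prod N)) (E1 w) ≤
      (μ.prod H) {p | ∑ i, p.2 i < ∑ l, p.1 l ^ 2} := fun w =>
    (((measurePreserving_eval (fun _ : Fin M => μ) w).prod
      (measurePreserving_fst (μ := H) (ν := N))).measure_preimage hO.nullMeasurableSet).le
  have hE2 : ∀ w, (Q.prod (H.prod N)) (E2 w) ≤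
      (μ.prod N) {p | ¬ PassesThreshold Pt σ2 M p.1 (p.1 + p.2)} := fun w =>
    (((measurePreserving_eval (fun _ : Fin M => μ) w).prod
      (measurePreserving_snd (μ := H) (ν := N))).measure_preimage hA.compl.nullMeasurableSet).le
  have hE3 : ∀ w i, (Q.prod (H.prod N)) (E3 w i) ≤
      (μ.prod (iidGaussian n (Pt + σ2))) {p | PassesThreshold Pt σ2 M p.1 p.2} := by
    intro w i
    by_cases hiw : i = w
    · simp [E3, hiw]
    · have h1 := (measurePreserving_eval_pair μ hiw).prod
        (measurePreserving_snd (μ := H) (ν := N))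
      have h2 := (MeasurePreserving.id μ).prod (measurePreserving_add_iidGaussian n Pt σ2)
      have h3 := h2.comp ((measurePreserving_prodAssoc μ μ N).comp h1)
      refine le_trans (measure_mono ?_) (h3.measure_preimage hA'.nullMeasurableSet).le
      exact fun p hp => hp.2
  have hE3U : ∀ w, (Q.prod (H.prod N)) (⋃ i, E3 w i) ≤
      M * (μ.prod (iidGaussian n (Pt + σ2))) {p | PassesThreshold Pt σ2 M p.1 p.2} := by
    intro w
    refine (measure_iUnion_fintype_le _ _).trans ((Finset.sum_le_sum fun i _ => hE3 w i).trans ?_)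
    simp
  have key : ((Q.prod (uniformOn (Set.univ : Set (Fin M)))).prod
      ((uniformOn (Set.univ : Set (Fin M))).prod (H.prod N)))
      {p | thresholdDecode Pt σ2 p.1.1 p.1.2 (transmit (p.1.1 p.2.1) p.2.2.1 + p.2.2.2) ≠ p.2.1} ≤
      (μ.prod H) {p | ∑ i, p.2 i < ∑ l, p.1 l ^ 2} +
      (μ.prod N) {p | ¬ PassesThreshold Pt σ2 M p.1 (p.1 + p.2)} +
      M * (μ.prod (iidGaussian n (Pt + σ2))) {p | PassesThreshold Pt σ2 M p.1 p.2} := by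
    refine le_trans (measure_mono (t := ({p | (p.1.1, p.2.2) ∈ E1 p.2.1} ∪
      {p | (p.1.1, p.2.2) ∈ E2 p.2.1}) ∪ {p | (p.1.1, p.2.2) ∈ ⋃ i, E3 p.2.1 i}) ?_) ?_
    · intro p hp
      rcases error_cases hp with h | h | ⟨i, hi⟩
      · exact Or.inl (Or.inl h)
      · exact Or.inl (Or.inr h)
      · exact Or.inr (Set.mem_iUnion.2 ⟨i, hi⟩)
    · refine (measure_union_le _ _).trans (add_le_add ((measure_union_le _ _).trans
        (add_le_add ?_ ?_)) ?_)
      · exact prod_uniformOn_prod_le hM Q (H.prod N) E1 hE1m hE1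
      · exact prod_uniformOn_prod_le hM Q (H.prod N) E2 hE2m hE2
      · exact prod_uniformOn_prod_le hM Q (H.prod N) (fun w => ⋃ i, E3 w i)
          (fun w => MeasurableSet.iUnion fun i => hE3m w i) hE3U
  refine (ENNReal.toReal_mono ?_ key).trans ?_
  · finiteness
  · rw [ENNReal.toReal_add (by finiteness) (by finiteness),
      ENNReal.toReal_add (by finiteness) (by finiteness), ENNReal.toReal_mul,
      ENNReal.toReal_natCast]
    rfl

/-! ### Passing to a deterministic code. -/

theorem measurableSet_gaussianCodebook_error (m n M : ℕ) (Pt σ2 : ℝ≥0) :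
    MeasurableSet {p : ((Fin M → Fin n → ℝ) × Fin M) × Fin M × (Fin m → ℝ) × (Fin n → ℝ) |
      thresholdDecode Pt σ2 p.1.1 p.1.2 (transmit (p.1.1 p.2.1) p.2.2.1 + p.2.2.2) ≠ p.2.1} := by
  -- The error event depends only on the fallback, the set of passing indices and the message, which
  -- range over a finite type; joint measurability reduces to these three maps.
  have hT : MeasurableSet {q : Fin M × (Fin M → Prop) × Fin M | uniqueOr q.1 q.2.1 ≠ q.2.2} :=
    (Set.to_countable _).measurableSet
  have hcw : Measurable fun p : ((Fin M → Fin n → ℝ) × Fin M) × Fin M × (Fin m → ℝ) × (Fin n → ℝ) =>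
      p.1.1 p.2.1 := by
    have h : Measurable fun q : Fin M × (Fin M → Fin n → ℝ) => q.2 q.1 :=
      measurable_from_prod_countable_right fun w => measurable_pi_apply w
    exact h.comp (measurable_snd.fst.prodMk measurable_fst.fst)
  have hcwl := fun l => (measurable_pi_apply l).comp hcw
  have htr : Measurable fun p : ((Fin M → Fin n → ℝ) × Fin M) × Fin M × (Fin m → ℝ) × (Fin n → ℝ) =>
      transmit (p.1.1 p.2.1) p.2.2.1 := by
    refine measurable_pi_iff.2 fun l => ?_
    unfold transmit
    refine Measurable.ite (measurableSet_le (Finset.measurable_sum _ fun j _ =>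
      (hcwl j).pow_const 2) (by fun_prop)) (hcwl l) measurable_const
  refine (measurable_fst.snd.prodMk (Measurable.prodMk (measurable_pi_iff.2 fun i => ?_)
    measurable_snd.fst)) hT
  refine measurableSet_setOfPred.1 ?_
  exact (Measurable.prodMk ((measurable_pi_apply i).comp measurable_fst.fst)
    (htr.add measurable_snd.snd.snd)) (measurableSet_passesThreshold n Pt σ2 M)

/-- Some codebook and fallback message are at least as good as the random ones. -/
theorem exists_errorProb_le_gaussianCodebookError {m n M : ℕ} (hM : 0 < M) (Pt σ2 : ℝ≥0) {PE : ℝ≥0}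
    (hPE : 0 < PE) : ∃ (c : Fin M → Fin n → ℝ) (u : Fin M),
      (thresholdCode m Pt σ2 c u).errorProb PE σ2 ≤ gaussianCodebookError m n M Pt PE σ2 := by
  have := isProbabilityMeasure_uniformOn_univ hM
  have := isProbabilityMeasure_harvestLaw m hPE
  have hS := measurableSet_gaussianCodebook_error m n M Pt σ2
  obtain ⟨⟨c, u⟩, h⟩ := exists_le_lintegral
    (μ := (Measure.pi fun _ : Fin M => iidGaussian n Pt).prod
      (uniformOn (Set.univ : Set (Fin M))))
    (measurable_measure_prodMk_left (ν := (uniformOn (Set.univ : Set (Fin M))).prod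
      ((harvestLaw m PE).prod (iidGaussian n σ2))) hS).aemeasurable
  rw [← Measure.prod_apply hS] at h
  exact ⟨c, u, ENNReal.toReal_mono (by finiteness) h⟩

/-! ### Choice of parameters and numerical estimates. -/

/-- Rounding `exp r` up at most doubles it when `r ≥ 0`, and `2 < e`. -/
theorem exists_nat_log_mem_Icc {r : ℝ} (hr : 0 ≤ r) :
    ∃ M : ℕ, 0 < M ∧ r ≤ Real.log M ∧ Real.log M ≤ r + 1 := by
  have h1 : 0 < ⌈Real.exp r⌉₊ := Nat.ceil_pos.2 (Real.exp_pos r)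
  have h2 : (0 : ℝ) < ⌈Real.exp r⌉₊ := by exact_mod_cast h1
  refine ⟨⌈Real.exp r⌉₊, h1, (Real.le_log_iff_exp_le h2).2 (Nat.le_ceil _),
    (Real.log_le_iff_le_exp h2).2 ?_⟩
  have h3 := (Nat.ceil_lt_add_one (Real.exp_pos r).le).le
  have h4 : 1 ≤ Real.exp r := Real.one_le_exp hr
  have h5 := Real.exp_one_gt_d9
  rw [Real.exp_add]
  nlinarith

/-- Error bound for wrong codewords when `log M` stays below the mean information density by the
backoff `s √(n q)` and by `n ^ (1 / 4)`. -/
theorem mul_measureReal_passesThreshold_le {Pt σ2 : ℝ≥0} (hPt : 0 < Pt) (hσ2 : 0 < σ2) {n M : ℕ}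
    (hn : 0 < n) (hM : 0 < M) {q s : ℝ} (hq : q = Pt / (Pt + σ2))
    (hnq : 16 / 25 ≤ n * q)
    (hlog : Real.log M ≤ n * (Real.log (1 + Pt / σ2) / 2) - s * √(n * q) - (n : ℝ) ^ (1 / 4 : ℝ)) :
    M * ((iidGaussian n Pt).prod (iidGaussian n (Pt + σ2))).real
        {p | PassesThreshold Pt σ2 M p.1 p.2} ≤
      5 / 3 * Real.exp (-(4 / 5 * s) - (n : ℝ) ^ (1 / 4 : ℝ)) := by
  have hP : (0 : ℝ) < Pt := hPt
  have hσ : (0 : ℝ) < σ2 := hσ2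
  have hn' : (1 : ℝ) ≤ n := by exact_mod_cast hn
  have hM' : (0 : ℝ) < M := by exact_mod_cast hM
  set C := Real.log (1 + (Pt : ℝ) / σ2) / 2 with hC
  set F := (n : ℝ) ^ (1 / 4 : ℝ)
  have hroot : 4 / 5 ≤ √(n * q) := Real.le_sqrt_of_sq_le (by linarith)
  have hroot0 : 0 < √(n * q) := by linarith
  have hsq : √(n * q) ^ 2 = n * q := Real.sq_sqrt (by linarith)
  -- The Chernoff parameter is `1 - φ`. Compared with parameter `1`, the backoff gains `exp (-φ * s
  -- * √(n * q))`, at the cost of the factor `(1 - φ ^ 2 * q) ^ (-n / 2)`. This `φ` turns the gain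
  -- into `exp (-4s/5)` and keeps the cost bounded; `hnq` ensures `φ ≤ 1`.
  set φ : ℝ := 4 / 5 / √(n * q) with hφ
  have hφ0 : 0 ≤ φ := by positivity
  have hφ1 : φ ≤ 1 := (div_le_one hroot0).2 hroot
  have hφr : φ * √(n * q) = 4 / 5 := div_mul_cancel₀ _ hroot0.ne'
  have hφq : φ ^ 2 * q = 16 / 25 / n := by
    rw [eq_div_iff (by positivity)]
    calc φ ^ 2 * q * n = φ ^ 2 * √(n * q) ^ 2 := by rw [hsq]; ring
      _ = (φ * √(n * q)) ^ 2 := by ring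
      _ = 16 / 25 := by rw [hφr]; norm_num
  have hfac : 1 + 2 * (1 - φ) * ((Pt : ℝ) / σ2) - (1 - φ) ^ 2 * (Pt / σ2) =
      (1 + Pt / σ2) * (1 - 16 / 25 / n) := by
    rw [← hφq, hq]
    field_simp
    ring
  have h1 : (1 : ℝ) - 16 / 25 / n ≥ 9 / 25 := by
    have : 16 / 25 / (n : ℝ) ≤ 16 / 25 := div_le_self (by norm_num) hn'
    linarith
  -- Bernoulli's inequality gives `(1 - 16/(25n))^n ≥ 9/25`, whose inverse square root is `5/3`.
  have hpow : (√(1 - 16 / 25 / (n : ℝ)))⁻¹ ^ n ≤ 5 / 3 := by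
    have hb := one_add_mul_le_pow (a := -(16 / 25 / (n : ℝ))) (by linarith) n
    have hb' : (9 / 25 : ℝ) ≤ (1 - 16 / 25 / n) ^ n := by
      have : (n : ℝ) * (16 / 25 / n) = 16 / 25 := by field_simp
      rw [← sub_eq_add_neg] at hb
      linarith
    have h2 : 3 / 5 ≤ √(1 - 16 / 25 / (n : ℝ)) ^ n := by
      refine le_of_sq_le_sq ?_ (by positivity)
      rw [← pow_mul, mul_comm n 2, pow_mul, Real.sq_sqrt (by linarith)]
      linarith
    rw [inv_pow]
    calc _ ≤ (3 / 5 : ℝ)⁻¹ := inv_anti₀ (by norm_num) h2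
      _ = 5 / 3 := by norm_num
  have hgam : (√(1 + (Pt : ℝ) / σ2))⁻¹ ^ n = Real.exp (-(n * C)) := by
    rw [Real.exp_neg, Real.exp_nat_mul, inv_pow, hC, Real.exp_half,
      Real.exp_log (by positivity)]
  have hch := measureReal_lt_sum_letterInfo_le hPt hσ2 (θ := 1 - φ) (by linarith) (by linarith) n
    (Real.log M + F - n * C)
  rw [hfac, Real.sqrt_mul (by positivity), mul_inv, mul_pow, hgam] at hch
  simp_rw [passesThreshold_iff hσ2]
  calc _ ≤ M * (Real.exp (-(1 - φ) * (Real.log M + F - n * C)) *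
        (Real.exp (-(n * C)) * (√(1 - 16 / 25 / (n : ℝ)))⁻¹ ^ n)) :=
        mul_le_mul_of_nonneg_left hch hM'.le
    _ = (√(1 - 16 / 25 / (n : ℝ)))⁻¹ ^ n *
        Real.exp (φ * (Real.log M - n * C) - (1 - φ) * F) := by
        have h2 : M * Real.exp (-(1 - φ) * (Real.log M + F - n * C)) * Real.exp (-(n * C)) =
            Real.exp (φ * (Real.log M - n * C) - (1 - φ) * F) := by
          nth_rewrite 1 [← Real.exp_log hM']
          rw [← Real.exp_add, ← Real.exp_add]
          congr 1
          ring
        rw [← h2]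
        ring
    _ ≤ 5 / 3 * Real.exp (-(4 / 5 * s) - F) := by
        refine mul_le_mul hpow (Real.exp_le_exp.2 ?_) (Real.exp_pos _).le (by norm_num)
        -- `log M` is also backed off by `F`; this restores the `φ * F` lost from the threshold.
        have h3 := mul_le_mul_of_nonneg_left hlog hφ0
        have h4 : φ * (s * √(n * q)) = 4 / 5 * s := by rw [mul_left_comm, hφr]; ring
        linarith

/-- A positive rate expression needs a non-negligible total signal-to-noise ratio. -/
theorem le_nat_mul_of_two_le {g : ℝ} (hg : 0 < g) {n : ℕ} (hn : 0 < n)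
    (h : 2 ≤ n * (Real.log (1 + g) / 2)) : 16 / 25 ≤ n * (g / (1 + g)) := by
  have hn' : (1 : ℝ) ≤ n := by exact_mod_cast hn
  have h1 : Real.log (1 + g) ≤ g := by
    have := Real.log_le_sub_one_of_pos (show 0 < 1 + g by positivity)
    linarith
  have h2 : 4 ≤ n * g := by nlinarith
  rw [← mul_div_assoc, le_div_iff₀ (by positivity)]
  nlinarith

/-- The claim is `10/3 * (s² - 1) ≤ exp (4s/5 + 1)`. Bounding the square root of the right side by
the tangent of `exp` at `5/3` leaves a quadratic inequality in `s`. -/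
theorem five_thirds_mul_exp_le {s : ℝ} (hs : 1 < s) :
    5 / 3 * Real.exp (-(4 / 5 * s) - 1) ≤ 1 / (2 * (s ^ 2 - 1)) := by
  have hs2 : 0 < s ^ 2 - 1 := by nlinarith
  -- Compare cubes: `5.29³ < e⁵`.
  have h5 : (529 / 100 : ℝ) ≤ Real.exp (5 / 3) := by
    refine le_of_pow_le_pow_left₀ (n := 3) (by norm_num) (Real.exp_pos _).le ?_
    rw [← Real.exp_nat_mul, show ((3 : ℕ) : ℝ) * (5 / 3) = ((5 : ℕ) : ℝ) * 1 by norm_num,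
      Real.exp_nat_mul]
    calc (529 / 100 : ℝ) ^ 3 ≤ 2.7182818283 ^ 5 := by norm_num
      _ ≤ _ := pow_le_pow_left₀ (by norm_num) Real.exp_one_gt_d9.le 5
  have h1 : 529 / 100 * (2 / 5 * s - 1 / 6) ≤ Real.exp (2 / 5 * s + 1 / 2) := by
    have h2 := Real.add_one_le_exp (2 / 5 * s + 1 / 2 - 5 / 3)
    have h3 : Real.exp (2 / 5 * s + 1 / 2) =
        Real.exp (5 / 3) * Real.exp (2 / 5 * s + 1 / 2 - 5 / 3) := by
      rw [← Real.exp_add]; congr 1; ring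
    rw [h3]
    exact mul_le_mul h5 (by linarith) (by linarith) (Real.exp_pos _).le
  have h4 : 10 / 3 * (s ^ 2 - 1) ≤ Real.exp (4 / 5 * s + 1) := by
    rw [show 4 / 5 * s + 1 = (2 / 5 * s + 1 / 2) + (2 / 5 * s + 1 / 2) by ring, Real.exp_add]
    have := mul_le_mul h1 h1 (by nlinarith) (Real.exp_pos _).le
    nlinarith [sq_nonneg (s - 8 / 5)]
  rw [show -(4 / 5 * s) - 1 = -(4 / 5 * s + 1) by ring, Real.exp_neg, ← div_eq_mul_inv,
    div_le_div_iff₀ (Real.exp_pos _) (by positivity)]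
  linarith

/-- Here `1 - exp (-x)` bounds the outage. The split at `F = 4L/5` decides which hypothesis on `x`
is used: below it the budget is `ε/4 + ε/2 + ε/4`, above it `ε/(2+ε) + ε/(2+ε) + ε²/(2+ε)`, both
equal to `ε`. -/
theorem error_sum_le {ε : ℝ} (hε0 : 0 < ε) (hε1 : ε < 1) {s x F L : ℝ} (hs : 0 < s)
    (hs2 : s ^ 2 = (2 + ε) / ε) (hL : L = Real.log ((2 + ε) / ε ^ 2)) (hF : 1 ≤ F)
    (hx1 : x ≤ Real.log (1 + ε / 2)) (hx2 : x * L ^ 4 ≤ F ^ 4 * Real.log (1 + ε / 2)) :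
    (1 - Real.exp (-x)) + ε / (2 + ε) + 5 / 3 * Real.exp (-(4 / 5 * s) - F) ≤ ε := by
  have hεs : s ^ 2 - 1 = 2 / ε := by rw [hs2]; field_simp; ring
  have hs3 : 3 / 2 < s := by
    have : 2 < 2 / ε := by rw [lt_div_iff₀ hε0]; linarith
    nlinarith
  have hL0 : 0 < L := by
    rw [hL]
    refine Real.log_pos ?_
    rw [lt_div_iff₀ (by positivity)]
    nlinarith
  have hc0 : 0 < Real.log (1 + ε / 2) := Real.log_pos (by linarith)
  have hc1 : Real.log (1 + ε / 2) ≤ ε / 2 := by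
    have := Real.log_le_sub_one_of_pos (show 0 < 1 + ε / 2 by positivity)
    linarith
  rcases le_or_gt F (4 / 5 * L) with hFL | hFL
  -- `(4/5)⁴ < 1/2`, so `hx2` halves the bound on `x`.
  · have hF4 : F ^ 4 ≤ L ^ 4 / 2 := by
      have := pow_le_pow_left₀ (by linarith) hFL 4
      have : 0 < L ^ 4 := by positivity
      nlinarith
    have hx : x ≤ ε / 4 := by
      have h1 : x * L ^ 4 ≤ ε / 4 * L ^ 4 := by
        linarith [mul_le_mul hF4 hc1 hc0.le (by positivity)]
      exact le_of_mul_le_mul_right h1 (by positivity)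
    have h1 : 1 - Real.exp (-x) ≤ ε / 4 := by linarith [Real.add_one_le_exp (-x)]
    have h2 : 5 / 3 * Real.exp (-(4 / 5 * s) - F) ≤ ε / 4 := by
      calc _ ≤ 5 / 3 * Real.exp (-(4 / 5 * s) - 1) := by gcongr
        _ ≤ 1 / (2 * (s ^ 2 - 1)) := five_thirds_mul_exp_le (by linarith)
        _ = ε / 4 := by rw [hεs]; field_simp; norm_num
    have h3 : ε / (2 + ε) ≤ ε / 2 := by gcongr; linarith
    linarith
  · have h1 : 1 - Real.exp (-x) ≤ ε / (2 + ε) := by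
      have := Real.exp_le_exp.2 (neg_le_neg hx1)
      rw [Real.exp_neg (Real.log _), Real.exp_log (by positivity)] at this
      have h2 : (1 + ε / 2)⁻¹ = 1 - ε / (2 + ε) := by field_simp; ring
      linarith
    -- From `exp L ≤ s⁴` and `log s ≤ s - 1`. The factor `exp (4/5 - 4s/5)` is thus at most `exp
    -- (-L/5)`, supplying the fifth of `L` that `F > 4L/5` leaves open.
    have hLs : L ≤ 4 * s - 4 := by
      have h3 : (2 + ε) / ε ^ 2 ≤ s ^ 4 := by
        rw [show s ^ 4 = (s ^ 2) ^ 2 by ring, hs2, div_pow]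
        gcongr
        nlinarith
      have h4 := Real.log_le_log (by positivity) h3
      rw [Real.log_pow, ← hL] at h4
      have := Real.log_le_sub_one_of_pos hs
      push_cast at h4
      linarith
    have h2 : 5 / 3 * Real.exp (-(4 / 5 * s) - F) ≤ ε ^ 2 / (2 + ε) := by
      have h3 : (5 / 3 : ℝ) ≤ Real.exp (4 / 5) := by
        linarith [Real.add_one_le_exp (4 / 5 : ℝ)]
      calc _ ≤ Real.exp (4 / 5) * Real.exp (-(4 / 5 * s) - F) := by gcongr
        _ = Real.exp (4 / 5 - 4 / 5 * s - F) := by rw [← Real.exp_add]; congr 1; ring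
        _ ≤ Real.exp (-L) := Real.exp_le_exp.2 (by linarith)
        _ = ε ^ 2 / (2 + ε) := by
          rw [hL, Real.exp_neg, Real.exp_log (by positivity), inv_div]
    have h3 : ε / (2 + ε) + ε / (2 + ε) + ε ^ 2 / (2 + ε) = ε := by field_simp; ring
    linarith

end WPC

/-! ### The main theorem. -/

theorem theorem1 (ε : ℝ) (hε0 : 0 < ε) (hε1 : ε < 1)
    (Pt PE σ2 : NNReal) (hPt : 0 < Pt) (hPE : 0 < PE) (hσ2 : 0 < σ2)
    (a γ : ℝ) (ha : a = (Pt : ℝ) / PE) (hγ : γ = (Pt : ℝ) / σ2)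
    (m n : ℕ)
    (hm : (m : ℝ) ≥ 2 * a /
      (Real.exp (2 * Real.log (1 + 0.5 * ε) / (Real.log ((2 + ε) / ε ^ 2)) ^ 4) - 1))
    (hn : (n : ℝ) ≤ 2 * (Real.log (1 + 0.5 * ε) / Real.log (1 + 2 * a / m))) :
    ∃ M : ℕ, 0 < M ∧
      WPC.ehRate ε m n γ ≤ Real.log M / ((n : ℝ) + m) ∧
      WPC.gaussianCodebookError m n M Pt PE σ2 ≤ ε ∧
      ∃ (c : Fin M → Fin n → ℝ) (u : Fin M),
        (WPC.thresholdCode m Pt σ2 c u).errorProb PE σ2 ≤ ε := by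
  suffices h : ∃ M : ℕ, 0 < M ∧ WPC.ehRate ε m n γ ≤ Real.log M / ((n : ℝ) + m) ∧
      WPC.gaussianCodebookError m n M Pt PE σ2 ≤ ε by
    obtain ⟨M, hM, hR, hE⟩ := h
    obtain ⟨c, u, hcu⟩ := WPC.exists_errorProb_le_gaussianCodebookError (m := m) (n := n) hM Pt σ2 hPE
    exact ⟨M, hM, hR, hE, c, u, hcu.trans hE⟩
  have hP : (0 : ℝ) < Pt := hPt
  have hE : (0 : ℝ) < PE := hPE
  have hσ : (0 : ℝ) < σ2 := hσ2
  have ha0 : 0 < a := ha ▸ by positivity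
  have hγ0 : 0 < γ := hγ ▸ by positivity
  rw [show 0.5 * ε = ε / 2 by ring] at hm hn
  set c := Real.log (1 + ε / 2) with hc
  set L := Real.log ((2 + ε) / ε ^ 2) with hL
  have hc0 : 0 < c := Real.log_pos (by linarith)
  have hL0 : 0 < L := by
    refine Real.log_pos ?_
    rw [lt_div_iff₀ (by positivity)]
    nlinarith
  have hexp : 0 < Real.exp (2 * c / L ^ 4) - 1 := by
    have := Real.add_one_lt_exp (show 2 * c / L ^ 4 ≠ 0 by positivity)
    have : 0 < 2 * c / L ^ 4 := by positivity
    linarith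
  have hm0 : (0 : ℝ) < m := lt_of_lt_of_le (by positivity) hm
  set ℓ := Real.log (1 + 2 * a / m) with hℓ
  have hℓ0 : 0 < ℓ := Real.log_pos (by have : 0 < 2 * a / m := by positivity
                                       linarith)
  -- This is the hypothesis on `m`, solved for the logarithm.
  have hℓ1 : ℓ ≤ 2 * c / L ^ 4 := by
    rw [hℓ, Real.log_le_iff_le_exp (by positivity)]
    rw [ge_iff_le, div_le_iff₀ hexp] at hm
    have : 2 * a / m ≤ Real.exp (2 * c / L ^ 4) - 1 := by rw [div_le_iff₀ hm0]; linarith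
    linarith
  set F := (n : ℝ) ^ (1 / 4 : ℝ) with hF
  set r := (n : ℝ) * Real.log (1 + γ) / 2 - √((2 + ε) / ε * (γ / (γ + 1)) * n) - F - 1 with hr
  have hrate : WPC.ehRate ε m n γ = r / ((n : ℝ) + m) := rfl
  have hnm : (0 : ℝ) < n + m := by positivity
  rw [hrate]
  rcases le_or_gt r 0 with hr0 | hr0
  -- With a single message the decoder cannot err.
  · refine ⟨1, one_pos, ?_, ?_⟩
    · rw [Nat.cast_one, Real.log_one, zero_div]
      exact div_nonpos_of_nonpos_of_nonneg hr0 hnm.le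
    · rw [WPC.gaussianCodebookError, show {p : ((Fin 1 → Fin n → ℝ) × Fin 1) × Fin 1 ×
          (Fin m → ℝ) × (Fin n → ℝ) | WPC.thresholdDecode Pt σ2 p.1.1 p.1.2
          (WPC.transmit (p.1.1 p.2.1) p.2.2.1 + p.2.2.2) ≠ p.2.1} = ∅ from
          Set.eq_empty_of_forall_notMem fun p hp => hp (Subsingleton.elim _ _)]
      simpa using hε0.le
  obtain ⟨M, hM, hM1, hM2⟩ := WPC.exists_nat_log_mem_Icc hr0.le
  refine ⟨M, hM, by gcongr, ?_⟩
  have hn0 : 0 < n := by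
    rcases Nat.eq_zero_or_pos n with h | h
    · exfalso
      rw [hr, hF, h] at hr0
      norm_num at hr0
    · exact h
  have hn1 : (1 : ℝ) ≤ n := by exact_mod_cast hn0
  have hF1 : 1 ≤ F := Real.one_le_rpow hn1 (by norm_num)
  have hF4 : F ^ 4 = n := by
    rw [hF, ← Real.rpow_natCast, ← Real.rpow_mul (by positivity)]
    norm_num
  set q : ℝ := Pt / (Pt + σ2) with hq
  have hqγ : q = γ / (1 + γ) := by rw [hq, hγ]; field_simp; ring
  have hq0 : 0 < q := by positivity
  set s := √((2 + ε) / ε) with hs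
  have hs0 : 0 < s := by positivity
  have hs2 : s ^ 2 = (2 + ε) / ε := Real.sq_sqrt (by positivity)
  have hD : √((2 + ε) / ε * (γ / (γ + 1)) * n) = s * √(n * q) := by
    rw [hs, ← Real.sqrt_mul (by positivity), hqγ, add_comm γ 1]
    congr 1
    ring
  have hD0 : 0 < s * √(n * q) := by positivity
  have hlog : Real.log M ≤ n * (Real.log (1 + Pt / σ2) / 2) - s * √(n * q) - F := by
    rw [hr, hD] at hM2
    rw [← hγ]
    linarith
  -- Positivity of `r` together with `F ≥ 1` forces the mean information density to exceed `2`.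
  have hnq : 16 / 25 ≤ n * q := by
    rw [hqγ]
    refine WPC.le_nat_mul_of_two_le hγ0 hn0 ?_
    rw [hr, hD] at hr0
    linarith
  have hwrong := WPC.mul_measureReal_passesThreshold_le hPt hσ2 hn0 hM hq hnq hlog
  have hout := WPC.measureReal_outage_le (m := m) (by exact_mod_cast hm0) n hPt hPE
  have hpow : (√(1 + 2 * ((Pt : ℝ) / PE) / m))⁻¹ ^ n = Real.exp (-(n * (ℓ / 2))) := by
    rw [Real.exp_neg, Real.exp_nat_mul, inv_pow, ← ha, hℓ, Real.exp_half,
      Real.exp_log (by positivity)]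
  rw [hpow] at hout
  have hright : ((WPC.iidGaussian n Pt).prod (WPC.iidGaussian n σ2)).real
      {p | ¬ WPC.PassesThreshold Pt σ2 M p.1 (p.1 + p.2)} ≤ ε / (2 + ε) := by
    refine (measureReal_mono ?_).trans
      ((WPC.measureReal_sum_letterInfo_add_le hPt hσ2 n hD0).trans_eq ?_)
    · intro p hp
      have hp' : ¬ WPC.PassesThreshold Pt σ2 M p.1 (p.1 + p.2) := hp
      rw [WPC.passesThreshold_iff hσ2, not_lt] at hp'
      exact Set.mem_ofPred.2 (by linarith)
    · rw [mul_pow, hs2, Real.sq_sqrt (show 0 ≤ n * q by positivity), ← hq]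
      field_simp
  have hx1 : n * (ℓ / 2) ≤ c := by
    rw [← mul_div_assoc, le_div_iff₀ hℓ0] at hn
    linarith
  -- Since `F ^ 4 = n`, this is `hℓ1` multiplied by `n / 2`.
  have hx2 : n * (ℓ / 2) * L ^ 4 ≤ F ^ 4 * c := by
    rw [le_div_iff₀ (by positivity)] at hℓ1
    rw [hF4]
    linarith [mul_le_mul_of_nonneg_left hℓ1 (Nat.cast_nonneg (α := ℝ) n)]
  have htot := WPC.error_sum_le hε0 hε1 hs0 hs2 hL hF1 hx1 hx2
  have := WPC.gaussianCodebookError_le (m := m) (n := n) hM Pt σ2 hPE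
  linarith
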